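/- **Setting.** Let $n\ge 1$, $K\ge 1$, $d\ge 0$ be integers and let $f_1,\dots,f_n:\mathbb R^d\to\mathbb R$ be twice differentiable with $\sigma I\preceq\nabla^2 f_j(x)\preceq L I$ for all $x$ and $j$, where $0<\sigma\le L$. Put $\kappa=L/\sigma$, $f=\frac1n\sum_j f_j$, $y^{\mathsf{opt}}=\arg\min f$ and $\beta=\max_j\sup_x\|\nabla^2f_j(x)-\nabla^2f(x)\|$ (spectral norm). Let $\mathcal G$ be an undirected graph on $\{1,\dots,n\}$ and $W=(w_{ij})\in\mathbb R^{n\times n}$ a matrix with $w_{ij}=0$ whenever $i\ne j$ are not adjacent, $W\mathbf 1=\mathbf 1$, $W^\top\mathbf 1=\mathbf 1$ and $\alpha_0=\|W-\frac1n\mathbf 1\mathbf 1^\top\|<1$. Put $\alpha=\alpha_0^K$. **Network-DANE** with parameter $\mu$, started at arbitrary $x_j^{(0)}\in\mathbb R^d$: set $y_j^{(0)}=x_j^{(0)}$, $s_j^{(0)}=\nabla f_j(y_j^{(0)})$. Iteration $t=1,2,\dots$: starting from $y_j^{(t),0}=x_j^{(t-1)}$ and $s_j^{(t),0}=s_j^{(t-1)}$,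 perform $K$ communication rounds $y_j^{(t),k}=\sum_i w_{ji}y_i^{(t),k-1}$, $s_j^{(t),k}=\sum_i w_{ji}s_i^{(t),k-1}$ (sums over $i=j$ and the neighbors $i$ of $j$), then set $$y_j^{(t)}=y_j^{(t),K},\qquad s_j^{(t)}=s_j^{(t),K}+\nabla f_j(y_j^{(t)})-\nabla f_j(y_j^{(t-1)}),$$ $$x_j^{(t)}=\arg\min_z\Big\{f_j(z)-\langle\nabla f_j(y_j^{(t)})-s_j^{(t)},z\rangle+\tfrac\mu2\|z-y_j^{(t)}\|_2^2\Big\}.$$ With $\overline y^{(t)}=\frac1n\sum_jy_j^{(t)}$, the error after iteration $t$ is $$e_t=\max\Big\{\sqrt n\,\|\overline y^{(t)}-y^{\mathsf{opt}}\|_2,\ \Big(\sum_j\|y_j^{(t)}-\overline y^{(t)}\|_2^2\Big)^{1/2},\ L^{-1}\Big(\sum_j\|s_j^{(t)}-\nabla f(y_j^{(t)})\|_2^2\Big)^{1/2}\Big\}.$$ The algorithm converges linearly at rate $\rho\in(0,1)$ if for some $C>0$, which may depend on the instance and on the starting point, $e_t\le C\rho^t$ for all $t\ge1$; it is $\varepsilon$-accurate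 at $t$ if $e_t\le\varepsilon$. **Statement.** Take $\mu$ with $\sigma+\mu=\dfrac{180\,\kappa L}{(1-\alpha)^2}$, and let $$\rho_2=\max\Big\{\tfrac{1+\theta_2}2,\ \alpha+\tfrac{170\kappa}{1-\alpha}\tfrac{L}{\sigma+\mu},\ \tfrac{1+\alpha}2+\tfrac{2\beta}{\sigma+\mu}\Big\},\qquad \theta_2=1-\tfrac{\sigma}{\sigma+\mu}+\tfrac{\beta}{\sigma+\mu}\sqrt{1-\big(\tfrac{\mu}{\sigma+\mu}\big)^2}.$$ 1. There is a rate $\rho$, the same for all starting points, at which Network-DANE converges linearly and which satisfies $$\rho\le\rho_2\qquad\text{and}\qquad \rho\le1-\Big(\frac{1-\alpha}{20}\Big)^2\frac1{\kappa^2}.$$ 2. The expression $\rho_2$ itself satisfies $\rho_2\le1-\big(\frac{1-\alpha}{21}\big)^2\frac1{\kappa^2}$, and moreover $\rho_2\le1-\big(\frac{1-\alpha}{20}\big)^2\frac1{\kappa^2}$ whenever $(1-\alpha)\beta\le\frac9{10}L$. 3. There is a universal constant $c>0$ (independent of all the data above) such that for every instance and every starting point there is $\varepsilon_0>0$ with the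 following property: for all $0<\varepsilon\le\varepsilon_0$ there is an integer $T$ with $$T\le c\,\frac{\kappa^2\log(1/\varepsilon)}{(1-\alpha)^2}$$ such that $e_t\le\varepsilon$ for all $t\ge T$, and the first $T$ iterations use at most $c\,K\,\dfrac{\kappa^2\log(1/\varepsilon)}{(1-\alpha)^2}$ communication rounds. -/

import Mathlib

namespace NetworkDANE

/-- The parameter space `ℝ^d` with its Euclidean norm. -/
abbrev Vec (d : ℕ) := EuclideanSpace ℝ (Fin d)

/-! ### Loss functions -/

/-- The global loss `f = (1/n) ∑ⱼ fⱼ`. -/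
noncomputable def globalLoss {n d : ℕ} (f : Fin n → Vec d → ℝ) : Vec d → ℝ :=
  fun x => (1 / (n : ℝ)) * ∑ j, f j x

/-- The Hessian `∇²g(x)`, as a continuous linear operator (the derivative of the gradient). -/
noncomputable def hessian {d : ℕ} (g : Vec d → ℝ) (x : Vec d) : Vec d →L[ℝ] Vec d :=
  fderiv ℝ (gradient g) x

/-- `g` is twice differentiable on `ℝ^d` and `σ I ≼ ∇²g(x) ≼ L I` for all `x`. -/
structure IsStronglyConvexSmooth {d : ℕ} (σ L : ℝ) (g : Vec d → ℝ) : Prop where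
  differentiable : Differentiable ℝ g
  differentiable_gradient : Differentiable ℝ (gradient g)
  lower : ∀ x v : Vec d, σ * ‖v‖ ^ 2 ≤ inner ℝ (hessian g x v) v
  upper : ∀ x v : Vec d, inner ℝ (hessian g x v) v ≤ L * ‖v‖ ^ 2

/-- The homogeneity parameter `β = maxⱼ supₓ ‖∇²fⱼ(x) - ∇²f(x)‖` (spectral norm). -/
noncomputable def homogeneity {n d : ℕ} (f : Fin n → Vec d → ℝ) : ℝ :=
  ⨆ j : Fin n, ⨆ x : Vec d, ‖hessian (f j) x - hessian (globalLoss f) x‖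

/-- A global minimizer of `g` (an arbitrary point if there is none). -/
noncomputable def argmin {d : ℕ} (g : Vec d → ℝ) : Vec d :=
  Classical.epsilon fun x => IsMinOn g Set.univ x

/-! ### The network -/

/-- `W` is a mixing matrix for the undirected graph `G`: off the diagonal it is supported on the
edges of `G`, and its rows and columns sum to one. -/
structure IsMixingMatrix {n : ℕ} (G : SimpleGraph (Fin n)) (W : Matrix (Fin n) (Fin n) ℝ) :
    Prop where
  support : ∀ i j, i ≠ j → ¬ G.Adj i j → W i j = 0
  col_sum : W.transpose.mulVec 1 = 1
  row_sum : W.mulVec 1 = 1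

/-- The mixing rate `α₀ = ‖W - (1/n) 1 1ᵀ‖` (spectral norm). -/
noncomputable def mixingRate {n : ℕ} (W : Matrix (Fin n) (Fin n) ℝ) : ℝ :=
  ‖Matrix.toEuclideanCLM (𝕜 := ℝ) (W - (1 / (n : ℝ)) • Matrix.of fun _ _ : Fin n => (1 : ℝ))‖

/-! ### The algorithm -/

/-- The values held by the agents during the mixing loop, with the number of communication rounds
performed so far. -/
structure MixState (n d : ℕ) where
  y : Fin n → Vec d
  s : Fin n → Vec d
  rounds : ℕ

/-- The values held by the agents after an iteration, with the number of communication rounds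
performed so far. -/
structure State (n d : ℕ) where
  x : Fin n → Vec d
  y : Fin n → Vec d
  s : Fin n → Vec d
  rounds : ℕ

open Classical in
/-- Weighted aggregation: agent `j` combines its own value with those of its neighbors. -/
noncomputable def aggregate {n d : ℕ} (G : SimpleGraph (Fin n)) (W : Matrix (Fin n) (Fin n) ℝ)
    (v : Fin n → Vec d) : Fin n → Vec d :=
  fun j => ∑ i ∈ Finset.univ.filter (fun i => i = j ∨ G.Adj j i), W j i • v i

/-- One communication round. -/
noncomputable def mixRound {n d : ℕ} (G : SimpleGraph (Fin n)) (W : Matrix (Fin n) (Fin n) ℝ)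
    (m : MixState n d) : MixState n d where
  y := aggregate G W m.y
  s := aggregate G W m.s
  rounds := m.rounds + 1

/-- The objective of the local subproblem,
`g(z) - ⟨∇g(y) - s, z⟩ + (μ/2) ‖z - y‖²`. -/
noncomputable def localObjective {d : ℕ} (μ : ℝ) (g : Vec d → ℝ) (y s : Vec d) : Vec d → ℝ :=
  fun z => g z - inner ℝ (gradient g y - s) z + μ / 2 * ‖z - y‖ ^ 2

/-- The state after the `K` mixing rounds at the start of an iteration. -/
noncomputable def mixed {n d : ℕ} (G : SimpleGraph (Fin n)) (W : Matrix (Fin n) (Fin n) ℝ)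
    (K : ℕ) (st : State n d) : MixState n d :=
  (mixRound G W)^[K] { y := st.x, s := st.s, rounds := st.rounds }

/-- The gradient-tracking update. -/
noncomputable def track {n d : ℕ} (G : SimpleGraph (Fin n)) (W : Matrix (Fin n) (Fin n) ℝ)
    (K : ℕ) (f : Fin n → Vec d → ℝ) (st : State n d) : Fin n → Vec d :=
  fun j => (mixed G W K st).s j
    + (gradient (f j) ((mixed G W K st).y j) - gradient (f j) (st.y j))

/-- One iteration of Network-DANE. -/
noncomputable def step {n d : ℕ} (G : SimpleGraph (Fin n)) (W : Matrix (Fin n) (Fin n) ℝ)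
    (K : ℕ) (μ : ℝ) (f : Fin n → Vec d → ℝ) (st : State n d) : State n d where
  x := fun j => argmin (localObjective μ (f j) ((mixed G W K st).y j) (track G W K f st j))
  y := (mixed G W K st).y
  s := track G W K f st
  rounds := (mixed G W K st).rounds

/-- The state of Network-DANE after `t` iterations from the initial estimates `x₀`. -/
noncomputable def run {n d : ℕ} (G : SimpleGraph (Fin n)) (W : Matrix (Fin n) (Fin n) ℝ)
    (K : ℕ) (μ : ℝ) (f : Fin n → Vec d → ℝ) (x₀ : Fin n → Vec d) : ℕ → State n d
  | 0 => { x := x₀, y := x₀, s := fun j => gradient (f j) (x₀ j), rounds := 0 }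
  | t + 1 => step G W K μ f (run G W K μ f x₀ t)

/-! ### Error metrics and convergence -/

/-- The average of the agents' vectors. -/
noncomputable def average {n d : ℕ} (v : Fin n → Vec d) : Vec d :=
  (1 / (n : ℝ)) • ∑ j, v j

/-- The Euclidean norm of the `nd`-dimensional vector obtained by stacking the agents' vectors. -/
noncomputable def stackNorm {n d : ℕ} (v : Fin n → Vec d) : ℝ :=
  Real.sqrt (∑ j, ‖v j‖ ^ 2)

/-- The largest of the (scaled) convergence error, the parameter consensus error and the (scaled)
gradient estimation error. -/
noncomputable def error {n d : ℕ} (L : ℝ) (f : Fin n → Vec d → ℝ) (st : State n d) : ℝ :=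
  max (Real.sqrt n * ‖average st.y - argmin (globalLoss f)‖)
    (max (stackNorm fun j => st.y j - average st.y)
      (L⁻¹ * stackNorm fun j => st.s j - gradient (globalLoss f) (st.y j)))

/-- The errors `e t` converge linearly at rate `ρ`. -/
def ConvergesLinearly (e : ℕ → ℝ) (ρ : ℝ) : Prop :=
  0 < ρ ∧ ρ < 1 ∧ ∃ C : ℝ, 0 < C ∧ ∀ t : ℕ, 1 ≤ t → e t ≤ C * ρ ^ t

/-! ### The rate -/

/-- `θ₂ = 1 - σ/(σ+μ) + (β/(σ+μ)) √(1 - (μ/(σ+μ))²)`. -/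
noncomputable def theta₂ (σ μ β : ℝ) : ℝ :=
  1 - σ / (σ + μ) + β / (σ + μ) * Real.sqrt (1 - (μ / (σ + μ)) ^ 2)

/-- `ρ₂ = max {(1+θ₂)/2, α + (170κ/(1-α)) (L/(σ+μ)), (1+α)/2 + 2β/(σ+μ)}` with `κ = L/σ`. -/
noncomputable def rho₂ (σ L μ α β : ℝ) : ℝ :=
  max ((1 + theta₂ σ μ β) / 2)
    (max (α + 170 * (L / σ) / (1 - α) * (L / (σ + μ)))
      ((1 + α) / 2 + 2 * β / (σ + μ)))

end NetworkDANE

/-! The agents' average performs an inexact gradient step on the global loss. Unit column sums keep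
the average tracker equal to the average local gradient (`average_tracker_run`). Averaging the local
optimality conditions then shows that the average of `y` moves as in a gradient step of length
`1/μ`: its distance to the minimizer shrinks by `1 - σ/μ`, up to `L/μ` times the disagreement of `y`
and the length of the local steps (`norm_average_local_step_le`). Local steps have length at most
`‖s‖/μ`, while mixing multiplies disagreement by `α = 1 - δ`.

The choice `σ + μ = 180 L²/(σ δ²)` makes the local steps short enough for the three errors, weighted
by `1`, `δσ/(60L)` and `σ/10`, to shrink together by `ρ = 1 - σ/(2(σ+μ)) = 1 - δ²/(360κ²)`
(`ErrorsLE.step`). This `ρ` does not involve `β`. It lies below the first entry of `ρ₂` because `β ≥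
0`, and it meets the bound with `20² = 400` since `360 ≤ 400`.

The bounds on `ρ₂` itself are a computation (`rho₂_le`): `β` costs at most a fraction `c` of the gap
`1 - ρ`, and `β ≤ L` limits that fraction. -/

namespace NetworkDANE

open Set

/-! ### Gradients, minimizers and the size of `β`. -/

section Gradient

variable {d : ℕ}

/-- `F` differs from multiplication by `m` by a Lipschitz map with constant `m - s`. -/
def IsNearScaling (m s : ℝ) (F : Vec d → Vec d) : Prop :=
  ∀ x y, ‖F x - F y - m • (x - y)‖ ≤ (m - s) * ‖x - y‖

theorem hessian_symmetric {g : Vec d → ℝ} (hg : Differentiable ℝ g)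
    (hg' : Differentiable ℝ (gradient g)) (x v w : Vec d) :
    inner ℝ (hessian g x v) w = inner ℝ v (hessian g x w) := by
  let B : Vec d →L[ℝ] Vec d →L[ℝ] ℝ := innerSL ℝ
  have h1 : ∀ y, HasFDerivAt g (B (gradient g y)) y := fun y =>
    (hg y).hasGradientAt.hasFDerivAt
  have h2 : HasFDerivAt (fun y => B (gradient g y)) (B.comp (hessian g x)) x :=
    B.hasFDerivAt.comp x (hg' x).hasFDerivAt
  have h3 := second_derivative_symmetric h1 h2 v w
  calc inner ℝ (hessian g x v) w = inner ℝ (hessian g x w) v := h3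
    _ = inner ℝ v (hessian g x w) := real_inner_comm _ _

theorem norm_le_of_symmetric_of_abs_inner_le {T : Vec d →L[ℝ] Vec d}
    (hT : ∀ v w, inner ℝ (T v) w = inner ℝ v (T w)) {c : ℝ} (hc : 0 ≤ c)
    (h : ∀ v, |inner ℝ (T v) v| ≤ c * ‖v‖ ^ 2) : ‖T‖ ≤ c := by
  rw [T.norm_eq_iSup_rayleighQuotient hT]
  refine Real.iSup_le (fun v => ?_) hc
  rw [ContinuousLinearMap.rayleighQuotient, abs_div, abs_of_nonneg (sq_nonneg ‖v‖)]
  exact div_le_of_le_mul₀ (sq_nonneg _) hc (h v)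

/-- The form of `∇²g - m I` lies between `σ - m` and `L - m`, and `m ≥ (σ+L)/2` makes `m - σ` the
larger modulus. Symmetry turns this into an operator norm bound, and the mean value inequality
integrates it. -/
theorem IsStronglyConvexSmooth.isNearScaling {σ L m : ℝ} {g : Vec d → ℝ}
    (hg : IsStronglyConvexSmooth σ L g) (hσ : σ ≤ L) (hm : (σ + L) / 2 ≤ m) :
    IsNearScaling m σ (gradient g) := by
  have hb : ∀ x ∈ (univ : Set (Vec d)),
      ‖fderiv ℝ (gradient g) x - m • ContinuousLinearMap.id ℝ (Vec d)‖ ≤ m - σ := by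
    intro x _
    refine norm_le_of_symmetric_of_abs_inner_le (fun v w => ?_) (by linarith) (fun v => ?_)
    · have := hessian_symmetric hg.differentiable hg.differentiable_gradient x v w
      rw [hessian] at this
      simp [inner_sub_left, inner_sub_right, inner_smul_left, inner_smul_right, this]
    · have h1 := hg.lower x v
      have h2 := hg.upper x v
      rw [hessian] at h1 h2
      have h3 := sq_nonneg ‖v‖
      simp only [_root_.sub_apply, _root_.smul_apply,
        ContinuousLinearMap.id_apply, inner_sub_left, inner_smul_left, conj_trivial,
        real_inner_self_eq_norm_sq]
      rw [abs_le]
      constructor <;> nlinarith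
  intro x y
  simpa using convex_univ.norm_image_sub_le_of_norm_fderiv_le'
    (fun x _ => hg.differentiable_gradient x) hb (mem_univ y) (mem_univ x)

theorem IsStronglyConvexSmooth.norm_gradient_sub_le {σ L : ℝ} {g : Vec d → ℝ}
    (hg : IsStronglyConvexSmooth σ L g) (hσ : 0 ≤ σ) (hσL : σ ≤ L) (x y : Vec d) :
    ‖gradient g x - gradient g y‖ ≤ L * ‖x - y‖ := by
  have h := hg.isNearScaling hσL le_rfl x y
  set m := (σ + L) / 2 with hm
  calc ‖gradient g x - gradient g y‖
      = ‖(gradient g x - gradient g y - m • (x - y)) + m • (x - y)‖ := by rw [sub_add_cancel]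
    _ ≤ (m - σ) * ‖x - y‖ + m * ‖x - y‖ := by
        refine (norm_add_le _ _).trans (add_le_add h ?_)
        rw [norm_smul, Real.norm_of_nonneg (by linarith)]
    _ = L * ‖x - y‖ := by rw [hm]; ring

theorem IsNearScaling.inner_ge {m s : ℝ} {F : Vec d → Vec d} (hF : IsNearScaling m s F)
    (x y : Vec d) : s * ‖x - y‖ ^ 2 ≤ inner ℝ (F x - F y) (x - y) := by
  have h1 := abs_le.1 (abs_real_inner_le_norm (F x - F y - m • (x - y)) (x - y))
  have h2 := mul_le_mul_of_nonneg_right (hF x y) (norm_nonneg (x - y))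
  rw [inner_sub_left, inner_smul_left, real_inner_self_eq_norm_sq, conj_trivial] at h1
  nlinarith [h1.1]

theorem IsNearScaling.average {n : ℕ} (hn : 0 < n) {m s : ℝ} {F : Fin n → Vec d → Vec d}
    (hF : ∀ j, IsNearScaling m s (F j)) :
    IsNearScaling m s (fun x => NetworkDANE.average fun j => F j x) := by
  intro x y
  have hn' : (n : ℝ) ≠ 0 := by positivity
  have : NetworkDANE.average (fun j => F j x) - NetworkDANE.average (fun j => F j y) - m • (x - y)
      = (1 / (n : ℝ)) • ∑ j, (F j x - F j y - m • (x - y)) := by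
    simp only [NetworkDANE.average, Finset.sum_sub_distrib, smul_sub, Finset.sum_const,
      Finset.card_univ, Fintype.card_fin, ← Nat.cast_smul_eq_nsmul ℝ, smul_smul]
    simp [hn']
  simp only [this]
  rw [norm_smul, Real.norm_of_nonneg (by positivity)]
  calc 1 / (n : ℝ) * ‖∑ j, (F j x - F j y - m • (x - y))‖
      ≤ 1 / (n : ℝ) * ∑ _j : Fin n, (m - s) * ‖x - y‖ := by
        gcongr
        exact norm_sum_le_of_le _ fun j _ => hF j x y
    _ = (m - s) * ‖x - y‖ := by
        simp [hn']

/-- The map `x ↦ x - m⁻¹ F x` contracts with factor `1 - s/m`, so Banach's theorem gives a fixed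
point. -/
theorem IsNearScaling.exists_zero {m s : ℝ} (hs : 0 < s) (hsm : s ≤ m) {F : Vec d → Vec d}
    (hF : IsNearScaling m s F) : ∃ x, F x = 0 := by
  have hm : 0 < m := hs.trans_le hsm
  have hK : 0 ≤ 1 - s / m := sub_nonneg.2 ((div_le_one hm).2 hsm)
  have hc : ContractingWith (1 - s / m).toNNReal (fun x => x - m⁻¹ • F x) := by
    refine ⟨?_, LipschitzWith.of_dist_le_mul fun x y => ?_⟩
    · rw [← NNReal.coe_lt_coe, Real.coe_toNNReal _ hK]
      simpa using div_pos hs hm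
    · have e : x - m⁻¹ • F x - (y - m⁻¹ • F y) = -(m⁻¹ • (F x - F y - m • (x - y))) := by
        rw [smul_sub m⁻¹ (F x - F y), smul_smul, inv_mul_cancel₀ hm.ne']
        module
      rw [dist_eq_norm, dist_eq_norm, e, norm_neg, norm_smul, norm_inv,
        Real.norm_of_nonneg hm.le]
      refine (mul_le_mul_of_nonneg_left (hF x y) (by positivity)).trans_eq ?_
      rw [Real.coe_toNNReal _ hK]
      field_simp
  refine ⟨ContractingWith.fixedPoint _ hc, ?_⟩
  have h : ContractingWith.fixedPoint _ hc - m⁻¹ • F (ContractingWith.fixedPoint _ hc)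
      = ContractingWith.fixedPoint _ hc := hc.fixedPoint_isFixedPt
  rw [sub_eq_self, smul_eq_zero] at h
  exact h.resolve_left (by positivity)

theorem isMinOn_of_monotone_gradient {G : Vec d → ℝ} {F : Vec d → Vec d}
    (hG : ∀ x, HasGradientAt G (F x) x) (hF : ∀ x y, 0 ≤ inner ℝ (F x - F y) (x - y))
    {x₀ : Vec d} (h₀ : F x₀ = 0) : IsMinOn G univ x₀ := by
  intro x _
  have hd : ∀ t : ℝ, HasDerivAt (fun t : ℝ => G (x₀ + t • (x - x₀)))
      (inner ℝ (F (x₀ + t • (x - x₀))) (x - x₀)) t := by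
    intro t
    have h1 : HasDerivAt (fun t : ℝ => x₀ + t • (x - x₀)) (x - x₀) t := by
      simpa using ((hasDerivAt_id t).smul_const (x - x₀)).const_add x₀
    exact (hG (x₀ + t • (x - x₀))).hasFDerivAt.comp_hasDerivAt t h1
  have hm : MonotoneOn (fun t : ℝ => G (x₀ + t • (x - x₀))) (Icc 0 1) := by
    refine monotoneOn_of_deriv_nonneg (convex_Icc 0 1)
      (fun t _ => (hd t).continuousAt.continuousWithinAt)
      (fun t _ => (hd t).differentiableAt.differentiableWithinAt) fun t ht => ?_
    rw [interior_Icc] at ht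
    rw [(hd t).deriv]
    have := hF (x₀ + t • (x - x₀)) x₀
    rw [h₀, sub_zero, add_sub_cancel_left, inner_smul_right] at this
    exact nonneg_of_mul_nonneg_right this ht.1
  have := hm (left_mem_Icc.2 zero_le_one) (right_mem_Icc.2 zero_le_one) zero_le_one
  simpa using this

/-- Since `argmin` is an arbitrary choice, a minimizer must first be produced: a zero of `F` is one,
by monotonicity along segments. -/
theorem gradient_argmin_eq_zero {m s : ℝ} (hs : 0 < s) (hsm : s ≤ m) {G : Vec d → ℝ}
    {F : Vec d → Vec d} (hG : ∀ x, HasGradientAt G (F x) x) (hF : IsNearScaling m s F) :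
    F (argmin G) = 0 := by
  obtain ⟨x₀, h₀⟩ := hF.exists_zero hs hsm
  have hex : ∃ x, IsMinOn G univ x := ⟨x₀, isMinOn_of_monotone_gradient hG
    (fun x y => le_trans (by positivity) (hF.inner_ge x y)) h₀⟩
  have hmin : IsMinOn G univ (argmin G) := Classical.epsilon_spec hex
  have h1 := (hmin.isLocalMin Filter.univ_mem).hasFDerivAt_eq_zero (hG _).hasFDerivAt
  simpa using h1

theorem hasGradientAt_localObjective {g : Vec d → ℝ} (hg : Differentiable ℝ g) (μ : ℝ)
    (y s z : Vec d) :
    HasGradientAt (localObjective μ g y s)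
      (gradient g z - (gradient g y - s) + μ • (z - y)) z := by
  rw [hasGradientAt_iff_hasFDerivAt]
  have h1 := (hg z).hasGradientAt.hasFDerivAt
  have h2 := (innerSL ℝ (gradient g y - s)).hasFDerivAt (x := z)
  have h3 := (((hasFDerivAt_id z).sub_const y).norm_sq).const_mul (μ / 2)
  refine ((h1.sub h2).add h3).congr_fderiv ?_
  ext v
  simp
  ring

theorem optimality_localObjective {σ L μ : ℝ} {g : Vec d → ℝ}
    (hg : IsStronglyConvexSmooth σ L g) (hσ : 0 < σ) (hσL : σ ≤ L) (hμ : 0 ≤ μ) (y s : Vec d) :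
    gradient g (argmin (localObjective μ g y s)) - (gradient g y - s)
      + μ • (argmin (localObjective μ g y s) - y) = 0 := by
  refine gradient_argmin_eq_zero (m := L + μ) (s := σ + μ) (by linarith) (by linarith)
    (fun z => hasGradientAt_localObjective hg.differentiable μ y s z) ?_
  intro a b
  have h := hg.isNearScaling hσL (m := L) (by linarith) a b
  have e : gradient g a - (gradient g y - s) + μ • (a - y)
      - (gradient g b - (gradient g y - s) + μ • (b - y)) - (L + μ) • (a - b)
      = gradient g a - gradient g b - L • (a - b) := by module
  rw [e]
  linarith

theorem hasGradientAt_globalLoss {n : ℕ} {f : Fin n → Vec d → ℝ}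
    (hf : ∀ j, Differentiable ℝ (f j)) (x : Vec d) :
    HasGradientAt (globalLoss f) (average fun j => gradient (f j) x) x := by
  rw [hasGradientAt_iff_hasFDerivAt]
  have h := (HasFDerivAt.fun_sum (u := Finset.univ)
    fun j _ => ((hf j) x).hasGradientAt.hasFDerivAt).const_mul (1 / (n : ℝ))
  refine h.congr_fderiv ?_
  ext v
  simp [average]

theorem gradient_globalLoss {n : ℕ} {f : Fin n → Vec d → ℝ}
    (hf : ∀ j, Differentiable ℝ (f j)) :
    gradient (globalLoss f) = fun x => average fun j => gradient (f j) x :=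
  gradient_eq (hasGradientAt_globalLoss hf)

theorem hessian_globalLoss {n : ℕ} {σ L : ℝ} {f : Fin n → Vec d → ℝ}
    (hf : ∀ j, IsStronglyConvexSmooth σ L (f j)) (x : Vec d) :
    hessian (globalLoss f) x = (1 / (n : ℝ)) • ∑ j, hessian (f j) x := by
  rw [hessian, gradient_globalLoss fun j => (hf j).differentiable]
  exact ((HasFDerivAt.fun_sum (u := Finset.univ)
    fun j _ => ((hf j).differentiable_gradient x).hasFDerivAt).const_smul (1 / (n : ℝ))).fderiv

theorem IsStronglyConvexSmooth.globalLoss {n : ℕ} (hn : 0 < n) {σ L : ℝ} {f : Fin n → Vec d → ℝ}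
    (hf : ∀ j, IsStronglyConvexSmooth σ L (f j)) :
    IsStronglyConvexSmooth σ L (globalLoss f) := by
  have hn' : (0 : ℝ) < n := by exact_mod_cast hn
  have e : ∀ x v, inner ℝ (hessian (NetworkDANE.globalLoss f) x v) v
      = (1 / (n : ℝ)) * ∑ j, inner ℝ (hessian (f j) x v) v := by
    intro x v
    rw [hessian_globalLoss hf]
    simp [sum_inner, inner_smul_left]
  refine ⟨fun x => (hasGradientAt_globalLoss (fun j => (hf j).differentiable) x).differentiableAt,
    ?_, fun x v => ?_, fun x v => ?_⟩
  · rw [gradient_globalLoss fun j => (hf j).differentiable]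
    unfold NetworkDANE.average
    exact (Differentiable.fun_sum (u := Finset.univ)
      fun j _ => (hf j).differentiable_gradient).const_smul (1 / (n : ℝ))
  · rw [e, one_div, ← div_eq_inv_mul, le_div_iff₀ hn']
    have := Finset.card_nsmul_le_sum Finset.univ (fun j => inner ℝ (hessian (f j) x v) v) _
      fun j _ => (hf j).lower x v
    simp at this
    linarith
  · rw [e, one_div, ← div_eq_inv_mul, div_le_iff₀ hn']
    have := Finset.sum_le_card_nsmul Finset.univ (fun j => inner ℝ (hessian (f j) x v) v) _
      fun j _ => (hf j).upper x v
    simp at this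
    linarith

theorem homogeneity_nonneg {n : ℕ} (f : Fin n → Vec d → ℝ) : 0 ≤ homogeneity f :=
  Real.iSup_nonneg fun _ => Real.iSup_nonneg fun _ => norm_nonneg _

/-- Both Hessians have quadratic forms in `[σ, L]`, so their difference has form at most `L - σ` in
modulus. -/
theorem homogeneity_le {n : ℕ} (hn : 0 < n) {σ L : ℝ} (hσL : σ ≤ L) {f : Fin n → Vec d → ℝ}
    (hf : ∀ j, IsStronglyConvexSmooth σ L (f j)) : homogeneity f ≤ L - σ := by
  have hg := IsStronglyConvexSmooth.globalLoss hn hf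
  refine Real.iSup_le (fun j => Real.iSup_le (fun x => ?_) (by linarith)) (by linarith)
  refine norm_le_of_symmetric_of_abs_inner_le (fun v w => ?_) (by linarith) fun v => ?_
  · simp only [_root_.sub_apply, inner_sub_left, inner_sub_right,
      hessian_symmetric (hf j).differentiable (hf j).differentiable_gradient x v w,
      hessian_symmetric hg.differentiable hg.differentiable_gradient x v w]
  · rw [_root_.sub_apply, inner_sub_left, abs_le]
    constructor <;> linarith [(hf j).lower x v, (hf j).upper x v, hg.lower x v, hg.upper x v]

end Gradient

/-! ### Averages, deviations and mixing. -/

section Network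

variable {n d : ℕ}

/-- The deviation of the agents' vectors from their average. -/
noncomputable def deviation (v : Fin n → Vec d) : Fin n → Vec d :=
  fun j => v j - average v

theorem stackNorm_eq_norm_toLp (v : Fin n → Vec d) :
    stackNorm v = ‖(WithLp.toLp 2 v : PiLp 2 fun _ : Fin n => Vec d)‖ :=
  (PiLp.norm_eq_of_L2 _).symm

theorem stackNorm_nonneg (v : Fin n → Vec d) : 0 ≤ stackNorm v :=
  Real.sqrt_nonneg _

theorem stackNorm_sq (v : Fin n → Vec d) : stackNorm v ^ 2 = ∑ j, ‖v j‖ ^ 2 :=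
  Real.sq_sqrt (Finset.sum_nonneg fun _ _ => sq_nonneg _)

theorem stackNorm_add_le (v w : Fin n → Vec d) :
    stackNorm (fun j => v j + w j) ≤ stackNorm v + stackNorm w := by
  simp only [stackNorm_eq_norm_toLp]
  exact norm_add_le (WithLp.toLp 2 v : PiLp 2 fun _ : Fin n => Vec d) (WithLp.toLp 2 w)

theorem stackNorm_le_of_norm_le {c : ℝ} (hc : 0 ≤ c) {v w : Fin n → Vec d}
    (h : ∀ j, ‖v j‖ ≤ c * ‖w j‖) : stackNorm v ≤ c * stackNorm w := by
  refine le_of_sq_le_sq ?_ (mul_nonneg hc (stackNorm_nonneg w))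
  rw [mul_pow, stackNorm_sq, stackNorm_sq, Finset.mul_sum]
  refine Finset.sum_le_sum fun j _ => ?_
  rw [← mul_pow]
  exact pow_le_pow_left₀ (norm_nonneg _) (h j) 2

theorem stackNorm_const (x : Vec d) : stackNorm (fun _ : Fin n => x) = √n * ‖x‖ := by
  simp [stackNorm]

theorem sum_eq_smul_average (hn : 0 < n) (v : Fin n → Vec d) :
    ∑ j, v j = (n : ℝ) • average v := by
  rw [average, smul_smul, mul_one_div_cancel (by positivity), one_smul]

theorem average_add (v w : Fin n → Vec d) :
    average (fun j => v j + w j) = average v + average w := by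
  simp [average, Finset.sum_add_distrib]

theorem average_sub (v w : Fin n → Vec d) :
    average (fun j => v j - w j) = average v - average w := by
  simp [average, Finset.sum_sub_distrib, smul_sub]

theorem average_smul (c : ℝ) (v : Fin n → Vec d) :
    average (fun j => c • v j) = c • average v := by
  rw [average, average, ← Finset.smul_sum, smul_comm]

theorem average_const (hn : 0 < n) (x : Vec d) : average (fun _ : Fin n => x) = x := by
  have : (n : ℝ) ≠ 0 := by positivity
  simp [average, ← Nat.cast_smul_eq_nsmul ℝ, smul_smul, this]

theorem deviation_add (v w : Fin n → Vec d) :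
    deviation (fun j => v j + w j) = fun j => deviation v j + deviation w j := by
  funext j
  simp only [deviation, average_add]
  abel

/-- Pythagoras: the deviation is orthogonal to the constant vectors. -/
theorem stackNorm_deviation_sq (hn : 0 < n) (v : Fin n → Vec d) :
    stackNorm (deviation v) ^ 2 + (√n * ‖average v‖) ^ 2 = stackNorm v ^ 2 := by
  have h : ∑ j, inner ℝ (v j) (average v) = n * ‖average v‖ ^ 2 := by
    rw [← sum_inner, sum_eq_smul_average hn, inner_smul_left, real_inner_self_eq_norm_sq]
    simp
  rw [stackNorm_sq, stackNorm_sq, mul_pow, Real.sq_sqrt (Nat.cast_nonneg n)]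
  simp only [deviation, norm_sub_sq_real, Finset.sum_add_distrib, Finset.sum_sub_distrib,
    ← Finset.mul_sum, h]
  simp
  ring

theorem stackNorm_deviation_le (hn : 0 < n) (v : Fin n → Vec d) :
    stackNorm (deviation v) ≤ stackNorm v :=
  le_of_sq_le_sq (by nlinarith [stackNorm_deviation_sq hn v, sq_nonneg (√n * ‖average v‖)])
    (stackNorm_nonneg v)

theorem sqrt_mul_norm_average_le (hn : 0 < n) (v : Fin n → Vec d) :
    √n * ‖average v‖ ≤ stackNorm v :=
  le_of_sq_le_sq (by nlinarith [stackNorm_deviation_sq hn v, sq_nonneg (stackNorm (deviation v))])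
    (stackNorm_nonneg v)

theorem stackNorm_sub_const_le (v : Fin n → Vec d) (x : Vec d) :
    stackNorm (fun j => v j - x) ≤ stackNorm (deviation v) + √n * ‖average v - x‖ := by
  rw [← stackNorm_const]
  refine le_trans (le_of_eq ?_) (stackNorm_add_le _ _)
  simp [deviation]

/-- The matrix acts on each of the `d` coordinates separately, so the squared operator norm bound
can be summed over coordinates. -/
theorem stackNorm_matrix_smul_le (A : Matrix (Fin n) (Fin n) ℝ) (v : Fin n → Vec d) :
    stackNorm (fun j => ∑ i, A j i • v i)
      ≤ ‖Matrix.toEuclideanCLM (𝕜 := ℝ) A‖ * stackNorm v := by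
  refine le_of_sq_le_sq ?_ (mul_nonneg (norm_nonneg _) (stackNorm_nonneg v))
  rw [mul_pow, stackNorm_sq, stackNorm_sq]
  simp only [EuclideanSpace.norm_sq_eq]
  rw [Finset.sum_comm, Finset.sum_comm (f := fun j k => ‖(v j) k‖ ^ 2), Finset.mul_sum]
  refine Finset.sum_le_sum fun k _ => ?_
  have h := (Matrix.toEuclideanCLM (𝕜 := ℝ) A).le_opNorm (WithLp.toLp 2 fun i => v i k)
  have h2 := pow_le_pow_left₀ (norm_nonneg _) h 2
  rw [mul_pow, EuclideanSpace.norm_sq_eq, EuclideanSpace.norm_sq_eq] at h2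
  simpa [Matrix.mulVec, dotProduct] using h2

variable {G : SimpleGraph (Fin n)} {W : Matrix (Fin n) (Fin n) ℝ}

theorem aggregate_apply (hW : IsMixingMatrix G W) (v : Fin n → Vec d) (j : Fin n) :
    aggregate G W v j = ∑ i, W j i • v i := by
  classical
  rw [aggregate]
  refine Finset.sum_subset_zero_on_sdiff (Finset.filter_subset _ _) (fun i hi => ?_)
    fun _ _ => rfl
  simp only [Finset.mem_sdiff, Finset.mem_univ, true_and, Finset.mem_filter, not_or] at hi
  rw [hW.support j i (Ne.symm hi.1) hi.2, zero_smul]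

theorem average_aggregate (hW : IsMixingMatrix G W) (v : Fin n → Vec d) :
    average (aggregate G W v) = average v := by
  have hc : ∀ i, ∑ j, W j i = 1 := fun i => by
    simpa [Matrix.mulVec, dotProduct] using congrFun hW.col_sum i
  simp only [average, aggregate_apply hW]
  rw [Finset.sum_comm]
  simp [← Finset.sum_smul, hc]

/-- By the unit row and column sums, the new deviation is `W - (1/n) 1 1ᵀ` applied to the old one.
-/
theorem stackNorm_deviation_aggregate_le (hn : 0 < n) (hW : IsMixingMatrix G W)
    (v : Fin n → Vec d) :
    stackNorm (deviation (aggregate G W v)) ≤ mixingRate W * stackNorm (deviation v) := by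
  have hr : ∀ j, ∑ i, W j i = 1 := fun j => by
    simpa [Matrix.mulVec, dotProduct] using congrFun hW.row_sum j
  have hn' : (n : ℝ) ≠ 0 := by positivity
  refine le_trans (le_of_eq ?_) (stackNorm_matrix_smul_le _ (deviation v))
  congr 1
  funext j
  rw [deviation, average_aggregate hW, aggregate_apply hW]
  simp only [Matrix.sub_apply, Matrix.smul_apply, Matrix.of_apply, deviation, smul_sub, sub_smul,
    Finset.sum_sub_distrib, ← Finset.sum_smul, hr]
  simp only [smul_eq_mul, mul_one, ← Finset.smul_sum, Finset.sum_const, Finset.card_univ,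
    Fintype.card_fin, nsmul_eq_mul, mul_one_div_cancel hn', one_smul]
  rw [← average]
  abel

theorem mixRound_iterate (hn : 0 < n) (hW : IsMixingMatrix G W) (m : MixState n d) (k : ℕ) :
    average ((mixRound G W)^[k] m).y = average m.y ∧
    average ((mixRound G W)^[k] m).s = average m.s ∧
    stackNorm (deviation ((mixRound G W)^[k] m).y)
      ≤ mixingRate W ^ k * stackNorm (deviation m.y) ∧
    stackNorm (deviation ((mixRound G W)^[k] m).s)
      ≤ mixingRate W ^ k * stackNorm (deviation m.s) ∧
    ((mixRound G W)^[k] m).rounds = m.rounds + k := by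
  have h0 : 0 ≤ mixingRate W := norm_nonneg _
  induction k with
  | zero => simp
  | succ k ih =>
    obtain ⟨h1, h2, h3, h4, h5⟩ := ih
    rw [Function.iterate_succ_apply']
    refine ⟨(average_aggregate hW _).trans h1, (average_aggregate hW _).trans h2, ?_, ?_, ?_⟩
    · refine (stackNorm_deviation_aggregate_le hn hW _).trans ?_
      rw [pow_succ', mul_assoc]
      exact mul_le_mul_of_nonneg_left h3 h0
    · refine (stackNorm_deviation_aggregate_le hn hW _).trans ?_
      rw [pow_succ', mul_assoc]
      exact mul_le_mul_of_nonneg_left h4 h0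
    · rw [mixRound, h5, add_assoc]

theorem rounds_run (hn : 0 < n) (hW : IsMixingMatrix G W) (K : ℕ) (μ : ℝ)
    (f : Fin n → Vec d → ℝ) (x₀ : Fin n → Vec d) (t : ℕ) :
    (run G W K μ f x₀ t).rounds = K * t := by
  induction t with
  | zero => rfl
  | succ t ih =>
    rw [run, step, mixed, (mixRound_iterate hn hW _ K).2.2.2.2, ih, Nat.mul_succ]

/-- The gradient-tracking invariant: mixing preserves averages and the corrections telescope. -/
theorem average_tracker_run (hn : 0 < n) (hW : IsMixingMatrix G W) (K : ℕ) (μ : ℝ)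
    (f : Fin n → Vec d → ℝ) (x₀ : Fin n → Vec d) (t : ℕ) :
    average (run G W K μ f x₀ t).s
      = average fun j => gradient (f j) ((run G W K μ f x₀ t).y j) := by
  induction t with
  | zero => rfl
  | succ t ih =>
    rw [run, step]
    unfold track
    rw [average_add, average_sub, mixed, (mixRound_iterate hn hW _ K).2.1]
    simp only [ih, add_sub_cancel]

end Network

/-! ### One iteration contracts the weighted errors. -/

section Recursion

variable {n d : ℕ} {f : Fin n → Vec d → ℝ} {σ L μ : ℝ} {y s x : Fin n → Vec d} {z : Vec d}

theorem average_gradient_argmin (hn : 0 < n) (hf : ∀ j, IsStronglyConvexSmooth σ L (f j))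
    (hσ : 0 < σ) (hσL : σ ≤ L) :
    average (fun j => gradient (f j) (argmin (globalLoss f))) = 0 :=
  gradient_argmin_eq_zero (m := L) hσ hσL
    (F := fun x => average fun j => gradient (f j) x)
    (hasGradientAt_globalLoss fun j => (hf j).differentiable)
    (IsNearScaling.average hn fun j => (hf j).isNearScaling hσL (by linarith))

/-- The average gradient vanishes at `z`, so the average tracker is an average of gradient
differences, controlled by the distance of `y` from `z`. -/
theorem stackNorm_tracker_le (hn : 0 < n) (hf : ∀ j, IsStronglyConvexSmooth σ L (f j))
    (hσ : 0 ≤ σ) (hσL : σ ≤ L) (hz : average (fun j => gradient (f j) z) = 0)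
    (hs : average s = average fun j => gradient (f j) (y j)) :
    stackNorm s ≤ stackNorm (deviation s)
      + L * (stackNorm (deviation y) + √n * ‖average y - z‖) := by
  have h1 := stackNorm_sub_const_le s 0
  simp only [sub_zero] at h1
  refine h1.trans (add_le_add_right ?_ _)
  have h2 : average s = average fun j => gradient (f j) (y j) - gradient (f j) z := by
    rw [average_sub, hz, sub_zero, hs]
  rw [h2]
  refine (sqrt_mul_norm_average_le hn _).trans ?_
  refine (stackNorm_le_of_norm_le (hσ.trans hσL) (w := fun j => y j - z) fun j =>
    (hf j).norm_gradient_sub_le hσ hσL _ _).trans ?_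
  exact mul_le_mul_of_nonneg_left (stackNorm_sub_const_le y z) (hσ.trans hσL)

/-- Pair the optimality condition with the step `x j - y j`; monotonicity of the gradient lets its
contribution be dropped. -/
theorem stackNorm_local_step_le (hf : ∀ j, IsStronglyConvexSmooth σ L (f j))
    (hσ : 0 ≤ σ) (hσL : σ ≤ L) (hμ : 0 < μ)
    (hx : ∀ j, gradient (f j) (x j) - (gradient (f j) (y j) - s j) + μ • (x j - y j) = 0) :
    stackNorm (fun j => x j - y j) ≤ μ⁻¹ * stackNorm s := by
  refine stackNorm_le_of_norm_le (by positivity) fun j => ?_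
  rw [← div_eq_inv_mul, le_div_iff₀ hμ]
  have hm := ((hf j).isNearScaling hσL (m := L) (by linarith)).inner_ge (x j) (y j)
  have he : gradient (f j) (x j) - gradient (f j) (y j) = -(s j) - μ • (x j - y j) := by
    rw [← sub_eq_zero, ← hx j]
    abel
  rw [he, inner_sub_left, inner_smul_left, real_inner_self_eq_norm_sq, conj_trivial,
    inner_neg_left] at hm
  have hc := abs_le.1 (abs_real_inner_le_norm (s j) (x j - y j))
  rcases (norm_nonneg (x j - y j)).eq_or_lt with h0 | h0
  · rw [← h0, zero_mul]
    exact norm_nonneg _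
  · refine le_of_mul_le_mul_right ?_ h0
    nlinarith [hc.1, mul_nonneg hσ (sq_nonneg ‖x j - y j‖)]

theorem norm_average_local_step_le (hn : 0 < n) (hf : ∀ j, IsStronglyConvexSmooth σ L (f j))
    (hσ : 0 ≤ σ) (hσL : σ ≤ L) (hμ : L ≤ μ) (hz : average (fun j => gradient (f j) z) = 0)
    (hs : average s = average fun j => gradient (f j) (y j))
    (hx : ∀ j, gradient (f j) (x j) - (gradient (f j) (y j) - s j) + μ • (x j - y j) = 0) :
    μ * (√n * ‖average x - z‖) ≤ (μ - σ) * (√n * ‖average y - z‖)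
      + L * stackNorm (deviation y) + L * stackNorm (fun j => x j - y j) := by
  have hL : 0 ≤ L := hσ.trans hσL
  have hnear := IsNearScaling.average hn
    (fun j => (hf j).isNearScaling hσL (m := μ) (by linarith)) (average y) z
  simp only [hz, sub_zero] at hnear
  have hav : average (fun j => gradient (f j) (x j) - gradient (f j) (y j))
      + average s + μ • (average x - average y) = 0 := by
    rw [← average_sub x y, ← average_smul, ← average_add, ← average_add]
    have : (fun j => gradient (f j) (x j) - gradient (f j) (y j) + s j + μ • (x j - y j))
        = fun _ => 0 := by
      funext j
      rw [← hx j]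
      abel
    rw [this, average_const hn]
  -- A gradient step at the average of `y`, with two errors: gradients are evaluated at the `y j`
  -- instead of their average, and they change between `y j` and `x j`.
  have e : μ • (average x - z)
      = -(average (fun j => gradient (f j) (average y)) - μ • (average y - z))
        - average (fun j => gradient (f j) (y j) - gradient (f j) (average y))
        - average (fun j => gradient (f j) (x j) - gradient (f j) (y j)) := by
    rw [average_sub (fun j => gradient (f j) (y j)), ← hs]
    rw [← sub_eq_zero, ← hav]
    module
  have h1 : √n * ‖average (fun j => gradient (f j) (y j) - gradient (f j) (average y))‖
      ≤ L * stackNorm (deviation y) :=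
    (sqrt_mul_norm_average_le hn _).trans (stackNorm_le_of_norm_le hL fun j =>
      (hf j).norm_gradient_sub_le hσ hσL _ _)
  have h2 : √n * ‖average (fun j => gradient (f j) (x j) - gradient (f j) (y j))‖
      ≤ L * stackNorm (fun j => x j - y j) :=
    (sqrt_mul_norm_average_le hn _).trans (stackNorm_le_of_norm_le hL fun j =>
      (hf j).norm_gradient_sub_le hσ hσL _ _)
  have h3 : μ * ‖average x - z‖ ≤ (μ - σ) * ‖average y - z‖
      + ‖average (fun j => gradient (f j) (y j) - gradient (f j) (average y))‖
      + ‖average (fun j => gradient (f j) (x j) - gradient (f j) (y j))‖ := by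
    have : μ * ‖average x - z‖ = ‖μ • (average x - z)‖ := by
      rw [norm_smul, Real.norm_of_nonneg (hL.trans hμ)]
    rw [this, e]
    refine (norm_sub_le _ _).trans (add_le_add_left ((norm_sub_le _ _).trans ?_) _)
    rw [norm_neg]
    exact add_le_add_left hnear _
  have h4 := mul_le_mul_of_nonneg_left h3 (Real.sqrt_nonneg n)
  linarith

variable {G : SimpleGraph (Fin n)} {W : Matrix (Fin n) (Fin n) ℝ}

theorem deviation_mixed_le (hn : 0 < n) (hW : IsMixingMatrix G W) (K : ℕ) (st : State n d) :
    stackNorm (deviation (step G W K μ f st).y) ≤ mixingRate W ^ K *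
      (stackNorm (deviation st.y) + stackNorm (fun j => st.x j - st.y j)) := by
  refine ((mixRound_iterate hn hW _ K).2.2.1).trans
    (mul_le_mul_of_nonneg_left ?_ (pow_nonneg (norm_nonneg _) K))
  have e : st.x = fun j => st.y j + (st.x j - st.y j) := by simp
  calc stackNorm (deviation st.x)
      = stackNorm (fun j => deviation st.y j + deviation (fun j => st.x j - st.y j) j) := by
        rw [← deviation_add, ← e]
    _ ≤ _ := (stackNorm_add_le _ _).trans (add_le_add_right (stackNorm_deviation_le hn _) _)

theorem deviation_track_le (hn : 0 < n) (hW : IsMixingMatrix G W)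
    (hα : mixingRate W ≤ 1) (hf : ∀ j, IsStronglyConvexSmooth σ L (f j))
    (hσ : 0 ≤ σ) (hσL : σ ≤ L) (K : ℕ) (st : State n d) :
    stackNorm (deviation (step G W K μ f st).s) ≤ mixingRate W ^ K * stackNorm (deviation st.s)
      + L * (2 * stackNorm (deviation st.y) + 2 * stackNorm (fun j => st.x j - st.y j)) := by
  have hα' : mixingRate W ^ K ≤ 1 := pow_le_one₀ (norm_nonneg _) hα
  -- The change of `y` splits into the new deviation, the move of the average and the old deviation;
  -- the factors 2 use only that mixing does not expand.
  have h1 : stackNorm (fun j => (step G W K μ f st).y j - st.y j)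
      ≤ 2 * stackNorm (deviation st.y) + 2 * stackNorm (fun j => st.x j - st.y j) := by
    have h2 := deviation_mixed_le (μ := μ) (f := f) hn hW K st
    have h3 : average (step G W K μ f st).y = average st.x := (mixRound_iterate hn hW _ K).1
    have h4 := sqrt_mul_norm_average_le hn (fun j => st.x j - st.y j)
    have h5 := stackNorm_sub_const_le (step G W K μ f st).y (average st.y)
    rw [h3, ← average_sub] at h5
    have h6 := stackNorm_add_le (fun j => (step G W K μ f st).y j - average st.y)
      (fun j => -deviation st.y j)
    have h7 : stackNorm (fun j => -deviation st.y j) = stackNorm (deviation st.y) := by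
      simp [stackNorm]
    simp only [deviation, neg_sub, sub_add_sub_cancel] at h6
    have h8 : 0 ≤ stackNorm (deviation st.y) + stackNorm (fun j => st.x j - st.y j) :=
      add_nonneg (stackNorm_nonneg _) (stackNorm_nonneg _)
    have h9 := mul_le_of_le_one_left h8 hα'
    simp only [deviation, neg_sub] at h7
    rw [h7] at h6
    change _ ≤ _ + stackNorm (deviation st.y) at h6
    linarith
  have e : (step G W K μ f st).s = fun j => (mixed G W K st).s j
      + (gradient (f j) ((step G W K μ f st).y j) - gradient (f j) (st.y j)) := rfl
  rw [e, deviation_add]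
  refine (stackNorm_add_le _ _).trans (add_le_add (mixRound_iterate hn hW _ K).2.2.2.1
    ((stackNorm_deviation_le hn _).trans ?_))
  exact (stackNorm_le_of_norm_le (hσ.trans hσL) fun j =>
    (hf j).norm_gradient_sub_le hσ hσL _ _).trans
    (mul_le_mul_of_nonneg_left h1 (hσ.trans hσL))

/-- The three errors of a state are at most `V`, up to fixed weights. -/
structure ErrorsLE (σ L δ : ℝ) (z : Vec d) (st : State n d) (V : ℝ) : Prop where
  optimality : √n * ‖average st.y - z‖ ≤ V
  consensus : stackNorm (deviation st.y) ≤ δ * σ / (60 * L) * V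
  tracking : stackNorm (deviation st.s) ≤ σ / 10 * V

theorem ErrorsLE.nonneg {δ V : ℝ} {st : State n d} (h : ErrorsLE σ L δ z st V) : 0 ≤ V :=
  (mul_nonneg (Real.sqrt_nonneg _) (norm_nonneg _)).trans h.optimality

theorem exists_errorsLE (hσ : 0 < σ) (hL : 0 < L) {δ : ℝ} (hδ : 0 < δ) (z : Vec d)
    (st : State n d) : ∃ V, ErrorsLE σ L δ z st V := by
  have h1 : 0 < δ * σ / (60 * L) := by positivity
  have h2 : 0 < σ / 10 := by positivity
  refine ⟨max (√n * ‖average st.y - z‖) (max (stackNorm (deviation st.y) / (δ * σ / (60 * L)))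
    (stackNorm (deviation st.s) / (σ / 10))), le_max_left _ _, ?_, ?_⟩
  · rw [← div_le_iff₀' h1]
    exact (le_max_left _ _).trans (le_max_right _ _)
  · rw [← div_le_iff₀' h2]
    exact (le_max_right _ _).trans (le_max_right _ _)

/-- The weights balance the couplings: consensus error is small enough to use only part of the gain
`σ/μ` of the average, and its factor `δ` lets the mixing gain absorb its effect on the trackers. -/
theorem ErrorsLE.step (hn : 0 < n) (hW : IsMixingMatrix G W) (hα : mixingRate W ≤ 1)
    (hf : ∀ j, IsStronglyConvexSmooth σ L (f j)) (hσ : 0 < σ) (hσL : σ ≤ L) {K : ℕ} {δ : ℝ}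
    (hδ : mixingRate W ^ K = 1 - δ) (hδ0 : 0 < δ) (hμ : (σ + μ) * (σ * δ ^ 2) = 180 * L ^ 2)
    (hz : average (fun j => gradient (f j) z) = 0) {st : State n d}
    (hs : average st.s = average fun j => gradient (f j) (st.y j))
    (hx : ∀ j, gradient (f j) (st.x j) - (gradient (f j) (st.y j) - st.s j)
      + μ • (st.x j - st.y j) = 0) {V : ℝ} (h : ErrorsLE σ L δ z st V) :
    ErrorsLE σ L δ z (step G W K μ f st) ((1 - σ / (2 * (σ + μ))) * V) := by
  have hL : 0 < L := hσ.trans_le hσL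
  have hδ1 : δ ≤ 1 := by
    have : 0 ≤ mixingRate W ^ K := pow_nonneg (norm_nonneg _) K
    linarith
  have hV := h.nonneg
  have hμ' : 179 * L ^ 2 ≤ μ * (σ * δ ^ 2) := by
    have h1 : δ ^ 2 ≤ 1 := pow_le_one₀ hδ0.le hδ1
    have h2 : σ ^ 2 ≤ L ^ 2 := pow_le_pow_left₀ hσ.le hσL 2
    nlinarith [mul_le_mul_of_nonneg_left h1 (sq_nonneg σ)]
  have hμL : 179 * L ≤ μ := by
    have h1 : σ * δ ^ 2 ≤ L := by
      have : δ ^ 2 ≤ 1 := pow_le_one₀ hδ0.le hδ1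
      nlinarith
    have hμ0 : 0 < μ := pos_of_mul_pos_left (lt_of_lt_of_le (by positivity) hμ') (by positivity)
    have h2 := mul_le_mul_of_nonneg_left h1 hμ0.le
    nlinarith
  have hμ0 : 0 < μ := by linarith
  set w := stackNorm (fun j => st.x j - st.y j) with hw
  have hw0 : 0 ≤ w := stackNorm_nonneg _
  -- The tracker norm is at most `(1/10 + 1/60 + 1) L V = (67/60) L V`; dividing by `μ ≥ 179
  -- L²/(σδ²)` suffices, as `179 · 60/67 > 158`.
  have hwV : w ≤ σ * δ ^ 2 / (158 * L) * V := by
    have h1 := stackNorm_local_step_le hf hσ.le hσL hμ0 hx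
    have h2 := stackNorm_tracker_le hn hf hσ.le hσL hz hs
    rw [← hw, ← div_eq_inv_mul, le_div_iff₀ hμ0] at h1
    have h3 : L * stackNorm (deviation st.y) ≤ L / 60 * V := by
      have := mul_le_mul_of_nonneg_left h.consensus hL.le
      have e : L * (δ * σ / (60 * L) * V) = δ * σ / 60 * V := by field_simp
      rw [e] at this
      refine this.trans (mul_le_mul_of_nonneg_right ?_ hV)
      nlinarith
    have h4 := h.tracking
    have h5 := mul_le_mul_of_nonneg_left h.optimality hL.le
    have h6 : σ / 10 * V ≤ L / 10 * V := mul_le_mul_of_nonneg_right (by linarith) hV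
    have h7 : w * μ ≤ 67 / 60 * L * V := by linarith
    have h8 : w * (179 * L ^ 2) ≤ 67 / 60 * L * V * (σ * δ ^ 2) := by
      calc w * (179 * L ^ 2) ≤ w * (μ * (σ * δ ^ 2)) := mul_le_mul_of_nonneg_left hμ' hw0
        _ = w * μ * (σ * δ ^ 2) := by ring
        _ ≤ _ := mul_le_mul_of_nonneg_right h7 (by positivity)
    have h9 : w * (158 * L) ≤ σ * δ ^ 2 * V := by
      refine le_of_mul_le_mul_right ?_ hL
      have : 0 ≤ L * V * (σ * δ ^ 2) := by positivity
      nlinarith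
    rw [div_mul_eq_mul_div, le_div_iff₀ (by positivity)]
    exact h9
  have hr : σ / (2 * (σ + μ)) ≤ δ / 360 := by
    rw [div_le_div_iff₀ (by positivity) (by norm_num)]
    have h1 : σ * δ ≤ L := by nlinarith
    have h2 : σ * (σ * δ) ≤ L * L := by
      apply mul_le_mul hσL h1 (by positivity) hL.le
    have h3 : (σ * 360) * (σ * δ) ≤ δ * (2 * (σ + μ)) * (σ * δ) := by nlinarith
    exact le_of_mul_le_mul_right h3 (by positivity)
  constructor
  · have h1 := norm_average_local_step_le hn hf hσ.le hσL (by linarith : L ≤ μ) hz hs hx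
    rw [← hw] at h1
    have h2 : average (NetworkDANE.step G W K μ f st).y = average st.x :=
      (mixRound_iterate hn hW _ K).1
    rw [h2]
    have h3 : L * stackNorm (deviation st.y) ≤ σ / 60 * V := by
      have := mul_le_mul_of_nonneg_left h.consensus hL.le
      have e : L * (δ * σ / (60 * L) * V) = δ * σ / 60 * V := by field_simp
      rw [e] at this
      refine this.trans (mul_le_mul_of_nonneg_right ?_ hV)
      nlinarith
    have h4 : L * w ≤ σ / 158 * V := by
      have := mul_le_mul_of_nonneg_left hwV hL.le
      have e : L * (σ * δ ^ 2 / (158 * L) * V) = σ * δ ^ 2 / 158 * V := by field_simp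
      rw [e] at this
      refine this.trans (mul_le_mul_of_nonneg_right ?_ hV)
      have : δ ^ 2 ≤ 1 := pow_le_one₀ hδ0.le hδ1
      nlinarith
    have h5 := mul_le_mul_of_nonneg_left h.optimality (by linarith : 0 ≤ μ - σ)
    -- The perturbations cost `σ/60 + σ/158`, below half of the gain `σ`.
    have h6 : μ * (√n * ‖average st.x - z‖) ≤ (μ - σ / 2) * V := by
      have := mul_nonneg hσ.le hV
      linarith
    have h7 : μ - σ / 2 ≤ μ * (1 - σ / (2 * (σ + μ))) := by
      have e : μ * (1 - σ / (2 * (σ + μ))) = μ - σ / 2 * (μ / (σ + μ)) := by field_simp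
      have : μ / (σ + μ) ≤ 1 := (div_le_one (by linarith)).2 (by linarith)
      rw [e]
      nlinarith
    have h8 := h6.trans (mul_le_mul_of_nonneg_right h7 hV)
    rw [mul_assoc] at h8
    exact le_of_mul_le_mul_left h8 hμ0
  · refine (deviation_mixed_le hn hW K st).trans ?_
    rw [hδ, ← hw]
    have h1 : stackNorm (deviation st.y) + w ≤ (1 + 60 / 158 * δ) * (δ * σ / (60 * L) * V) := by
      have e : (1 + 60 / 158 * δ) * (δ * σ / (60 * L) * V)
          = δ * σ / (60 * L) * V + σ * δ ^ 2 / (158 * L) * V := by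
        field_simp
      rw [e]
      exact add_le_add h.consensus hwV
    refine (mul_le_mul_of_nonneg_left h1 (by linarith)).trans ?_
    rw [← mul_assoc, mul_left_comm (δ * σ / (60 * L)), ← mul_assoc]
    have h2 : 0 ≤ δ * σ / (60 * L) * V := by positivity
    rw [mul_assoc _ (δ * σ / (60 * L)) V]
    refine mul_le_mul_of_nonneg_right ?_ h2
    -- Here `(1 - δ)(1 + (60/158) δ) ≤ 1 - (98/158) δ`, well below `1 - δ/360`.
    nlinarith
  · refine (deviation_track_le hn hW hα hf hσ.le hσL K st).trans ?_
    rw [hδ, ← hw]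
    have h1 := mul_le_mul_of_nonneg_left h.tracking (by linarith : 0 ≤ 1 - δ)
    have h2 : L * (2 * stackNorm (deviation st.y) + 2 * w)
        ≤ δ * (1 / 3 + 10 / 79) * (σ / 10 * V) := by
      have h3 := mul_le_mul_of_nonneg_left (add_le_add h.consensus hwV)
        (by linarith : 0 ≤ 2 * L)
      have e : 2 * L * (δ * σ / (60 * L) * V + σ * δ ^ 2 / (158 * L) * V)
          = δ * (1 / 3 + 10 / 79 * δ) * (σ / 10 * V) := by
        field_simp
        ring
      rw [e] at h3
      have h4 : δ * (1 / 3 + 10 / 79 * δ) * (σ / 10 * V)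
          ≤ δ * (1 / 3 + 10 / 79) * (σ / 10 * V) := by
        gcongr
        linarith
      linarith
    have h5 : ((1 - δ) + δ * (1 / 3 + 10 / 79)) * (σ / 10 * V)
        ≤ (1 - σ / (2 * (σ + μ))) * (σ / 10 * V) :=
      mul_le_mul_of_nonneg_right (by linarith) (by positivity)
    linarith

/-- The start is iteration 1 because the initial `x` need not solve the local problems. -/
theorem ErrorsLE.run (hn : 0 < n) (hW : IsMixingMatrix G W) (hα : mixingRate W ≤ 1)
    (hf : ∀ j, IsStronglyConvexSmooth σ L (f j)) (hσ : 0 < σ) (hσL : σ ≤ L) (hμ0 : 0 ≤ μ) {K : ℕ}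
    {δ : ℝ} (hδ : mixingRate W ^ K = 1 - δ) (hδ0 : 0 < δ)
    (hμ : (σ + μ) * (σ * δ ^ 2) = 180 * L ^ 2)
    (hz : average (fun j => gradient (f j) z) = 0) (x₀ : Fin n → Vec d) {V : ℝ}
    (h : ErrorsLE σ L δ z (run G W K μ f x₀ 1) V) (t : ℕ) :
    ErrorsLE σ L δ z (NetworkDANE.run G W K μ f x₀ (t + 1))
      ((1 - σ / (2 * (σ + μ))) ^ t * V) := by
  induction t with
  | zero => simpa using h
  | succ t ih =>
    rw [pow_succ', mul_assoc]
    exact ih.step hn hW hα hf hσ hσL hδ hδ0 hμ hz (average_tracker_run hn hW K μ f x₀ (t + 1))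
      fun j => optimality_localObjective (hf j) hσ hσL hμ0 _ _

theorem error_le_of_errorsLE (hn : 0 < n) (hf : ∀ j, IsStronglyConvexSmooth σ L (f j))
    (hσ : 0 < σ) (hσL : σ ≤ L) {δ : ℝ} (hδ1 : δ ≤ 1) {st : State n d}
    (hs : average st.s = average fun j => gradient (f j) (st.y j)) {V : ℝ}
    (h : ErrorsLE σ L δ (argmin (globalLoss f)) st V) : error L f st ≤ V := by
  have hL : 0 < L := hσ.trans_le hσL
  have hV := h.nonneg
  have hp : δ * σ / (60 * L) ≤ 1 / 60 := by
    rw [div_le_div_iff₀ (by positivity) (by norm_num)]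
    nlinarith
  have hb : stackNorm (deviation st.y) ≤ 1 / 60 * V :=
    h.consensus.trans (mul_le_mul_of_nonneg_right hp hV)
  refine max_le h.optimality (max_le (hb.trans (by linarith)) ?_)
  have hg := gradient_globalLoss fun j => (hf j).differentiable
  have hlip := (IsStronglyConvexSmooth.globalLoss hn hf).norm_gradient_sub_le hσ.le hσL
  have h1 : stackNorm (fun j => gradient (globalLoss f) (average st.y)
      - gradient (globalLoss f) (st.y j)) ≤ L * stackNorm (deviation st.y) :=
    stackNorm_le_of_norm_le hL.le fun j => by
      rw [norm_sub_rev]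
      exact hlip _ _
  have h2 : √n * ‖average st.s - gradient (globalLoss f) (average st.y)‖
      ≤ L * stackNorm (deviation st.y) := by
    rw [hg, hs, ← average_sub]
    exact (sqrt_mul_norm_average_le hn _).trans (stackNorm_le_of_norm_le hL.le fun j =>
      (hf j).norm_gradient_sub_le hσ.le hσL _ _)
  have h3 := stackNorm_sub_const_le st.s (gradient (globalLoss f) (average st.y))
  have h4 := stackNorm_add_le (fun j => st.s j - gradient (globalLoss f) (average st.y))
    (fun j => gradient (globalLoss f) (average st.y) - gradient (globalLoss f) (st.y j))
  simp only [sub_add_sub_cancel] at h4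
  rw [← div_eq_inv_mul, div_le_iff₀ hL]
  have h5 := mul_le_mul_of_nonneg_left hb hL.le
  have h6 : σ / 10 * V ≤ L / 10 * V := mul_le_mul_of_nonneg_right (by linarith) hV
  have h7 := h.tracking
  have h8 := mul_nonneg hL.le hV
  linarith

end Recursion

/-! ### Bounds on `ρ₂` and the iteration count. -/

section Rate

variable {σ L μ δ β : ℝ}

theorem one_sub_le_rho₂ (α : ℝ) (hM : 0 < σ + μ) (hβ : 0 ≤ β) :
    1 - σ / (2 * (σ + μ)) ≤ rho₂ σ L μ α β := by
  refine le_trans ?_ (le_max_left _ _)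
  have h : 0 ≤ β / (σ + μ) * √(1 - (μ / (σ + μ)) ^ 2) := by positivity
  have e : σ / (2 * (σ + μ)) = σ / (σ + μ) / 2 := by field_simp
  rw [theta₂, e]
  linarith

/-- The second and third entries equal `1 - δ/18` and at most `1 - δ/2 + δ/90`, leaving gaps far
above `δ/360`. Only the first entry is delicate, and `c` is the share of its gap that the `β` term
may consume. -/
theorem rho₂_le (hσ : 0 < σ) (hσL : σ ≤ L) (hδ0 : 0 < δ) (hδ1 : δ ≤ 1)
    (hμ : (σ + μ) * (σ * δ ^ 2) = 180 * L ^ 2) (hβL : β ≤ L) {c : ℝ} (hc : 0 ≤ c)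
    (hc' : (δ * β) ^ 2 ≤ 90 * (c * L) ^ 2) :
    rho₂ σ L μ (1 - δ) β ≤ 1 - (1 - c) * (σ / (2 * (σ + μ))) := by
  have hL : 0 < L := hσ.trans_le hσL
  have hM : 0 < σ + μ := pos_of_mul_pos_left (b := σ * δ ^ 2) (by rw [hμ]; positivity) (by positivity)
  have hratio : σ / (σ + μ) = (σ * δ / L) ^ 2 / 180 := by
    rw [div_pow, div_div, div_eq_div_iff hM.ne' (by positivity)]
    linear_combination -σ * hμ
  have hσδ : σ * δ / L ≤ δ := by
    rw [div_le_iff₀ hL]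
    nlinarith
  have hσδ0 : 0 ≤ σ * δ / L := by positivity
  have e2 : σ / (2 * (σ + μ)) = σ / (σ + μ) / 2 := by field_simp
  have hsmall : (1 - c) * (σ / (2 * (σ + μ))) ≤ δ / 360 := by
    rw [e2, hratio]
    have h1 : (σ * δ / L) ^ 2 ≤ δ * 1 := by
      rw [sq]
      exact mul_le_mul hσδ (hσδ.trans hδ1) hσδ0 hδ0.le
    nlinarith [mul_nonneg hc (sq_nonneg (σ * δ / L))]
  have hα : 1 - (1 - δ) = δ := by ring
  have hLM : L / (σ + μ) = σ * δ ^ 2 / (180 * L) := by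
    rw [div_eq_div_iff hM.ne' (by positivity)]
    linear_combination -hμ
  refine max_le ?_ (max_le ?_ ?_)
  · have h1 : β * √(1 - (μ / (σ + μ)) ^ 2) ≤ c * σ := by
      refine le_of_sq_le_sq ?_ (by positivity)
      have h2 : 1 - (μ / (σ + μ)) ^ 2 ≤ 2 * (σ / (σ + μ)) := by
        have e : μ / (σ + μ) = 1 - σ / (σ + μ) := by
          rw [eq_sub_iff_add_eq, ← add_div, add_comm, div_self hM.ne']
        rw [e]
        nlinarith [sq_nonneg (σ / (σ + μ))]
      have h3 : √(1 - (μ / (σ + μ)) ^ 2) ^ 2 ≤ 2 * (σ / (σ + μ)) := by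
        refine (pow_le_pow_left₀ (Real.sqrt_nonneg _) (Real.sqrt_le_sqrt h2) 2).trans_eq ?_
        exact Real.sq_sqrt (by positivity)
      rw [mul_pow]
      refine (mul_le_mul_of_nonneg_left h3 (sq_nonneg β)).trans ?_
      have e : β ^ 2 * (2 * (σ / (σ + μ))) = (δ * β) ^ 2 * (σ ^ 2 / (90 * L ^ 2)) := by
        rw [hratio]
        field_simp
        ring
      rw [e]
      refine (mul_le_mul_of_nonneg_right hc' (by positivity)).trans_eq ?_
      field_simp
    have h2 : β / (σ + μ) * √(1 - (μ / (σ + μ)) ^ 2) ≤ c * (σ / (σ + μ)) := by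
      rw [div_mul_eq_mul_div, ← mul_div_assoc]
      exact div_le_div_of_nonneg_right h1 hM.le
    rw [theta₂, e2]
    linarith
  · rw [hα, hLM]
    have e : 170 * (L / σ) / δ * (σ * δ ^ 2 / (180 * L)) = 17 / 18 * δ := by
      field_simp
      norm_num
    rw [e]
    linarith
  · have h1 : 2 * β / (σ + μ) ≤ δ / 90 := by
      calc 2 * β / (σ + μ) ≤ 2 * L / (σ + μ) := by gcongr
        _ = σ * δ / L * δ / 90 := by
          rw [mul_div_assoc, hLM]
          field_simp
          norm_num
        _ ≤ δ / 90 := by nlinarith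
    linarith

/-- Doubling the logarithm yields `q ^ t ≤ ε²`; the spare factor `ε` absorbs `C`. -/
theorem mul_pow_le_of_two_mul_log_div_le {q C ε a : ℝ} (hq0 : 0 ≤ q) (hq : q ≤ Real.exp (-a))
    (ha : 0 < a) (hC : 0 < C) (hε : 0 < ε) (hεC : C * ε ≤ 1) {T : ℕ}
    (hT : 2 * Real.log (1 / ε) / a ≤ T) {t : ℕ} (ht : T ≤ t) : C * q ^ t ≤ ε := by
  have h1 : q ^ t ≤ ε ^ 2 := by
    calc q ^ t ≤ Real.exp (-a) ^ t := pow_le_pow_left₀ hq0 hq t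
      _ = Real.exp (t * -a) := (Real.exp_nat_mul _ _).symm
      _ ≤ Real.exp (2 * Real.log ε) := by
        refine Real.exp_le_exp.2 ?_
        rw [div_le_iff₀ ha, one_div, Real.log_inv] at hT
        have : (T : ℝ) ≤ t := by exact_mod_cast ht
        nlinarith
      _ = ε ^ 2 := by
        rw [two_mul, Real.exp_add, Real.exp_log hε, sq]
  calc C * q ^ t ≤ C * ε ^ 2 := mul_le_mul_of_nonneg_left h1 hC.le
    _ = C * ε * ε := by ring
    _ ≤ ε := mul_le_of_le_one_left hε.le hεC

end Rate

end NetworkDANE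

/-! ### Assembly of the rate, the bounds on `ρ₂` and the complexity. -/

theorem corollary2 :
    ∃ c : ℝ, 0 < c ∧
      ∀ (n d K : ℕ) (G : SimpleGraph (Fin n)) (W : Matrix (Fin n) (Fin n) ℝ)
        (f : Fin n → NetworkDANE.Vec d → ℝ) (σ L μ α κ β : ℝ),
        0 < n → 0 < K →
        NetworkDANE.IsMixingMatrix G W → NetworkDANE.mixingRate W < 1 →
        0 < σ → σ ≤ L → (∀ j, NetworkDANE.IsStronglyConvexSmooth σ L (f j)) →
        α = NetworkDANE.mixingRate W ^ K → κ = L / σ → β = NetworkDANE.homogeneity f →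
        σ + μ = 180 * κ * L / (1 - α) ^ 2 →
        -- the rate: it obeys the general bound `ρ₂` and the simplified bound
        (∃ ρ : ℝ, ρ ≤ NetworkDANE.rho₂ σ L μ α β ∧
          ρ ≤ 1 - ((1 - α) / 20) ^ 2 * (1 / κ ^ 2) ∧
          ∀ x₀ : Fin n → NetworkDANE.Vec d,
            NetworkDANE.ConvergesLinearly
              (fun t => NetworkDANE.error L f (NetworkDANE.run G W K μ f x₀ t)) ρ) ∧
        -- the simplified bounds on the expression `ρ₂` itself
        NetworkDANE.rho₂ σ L μ α β ≤ 1 - ((1 - α) / 21) ^ 2 * (1 / κ ^ 2) ∧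
        ((1 - α) * β ≤ 9 / 10 * L →
          NetworkDANE.rho₂ σ L μ α β ≤ 1 - ((1 - α) / 20) ^ 2 * (1 / κ ^ 2)) ∧
        -- iterations and communication rounds to reach (and keep) `ε`-accuracy
        (∀ x₀ : Fin n → NetworkDANE.Vec d, ∃ ε₀ : ℝ, 0 < ε₀ ∧ ∀ ε : ℝ, 0 < ε → ε ≤ ε₀ →
          ∃ T : ℕ,
            (T : ℝ) ≤ c * (κ ^ 2 * Real.log (1 / ε) / (1 - α) ^ 2) ∧
            ((NetworkDANE.run G W K μ f x₀ T).rounds : ℝ)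
              ≤ c * (K * (κ ^ 2 * Real.log (1 / ε) / (1 - α) ^ 2)) ∧
            ∀ t : ℕ, T ≤ t →
              NetworkDANE.error L f (NetworkDANE.run G W K μ f x₀ t) ≤ ε) := by
  refine ⟨1000, by norm_num, ?_⟩
  intro n d K G W f σ L μ α κ β hn hK hW hα₀ hσ hσL hf hα hκ hβ hM
  have hL : 0 < L := hσ.trans_le hσL
  obtain ⟨δ, hδ⟩ : ∃ δ, δ = 1 - α := ⟨_, rfl⟩
  have hα0 : 0 ≤ α := hα ▸ pow_nonneg (norm_nonneg _) K
  have hα1 : α < 1 := hα ▸ pow_lt_one₀ (norm_nonneg _) hα₀ hK.ne'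
  have hδ0 : 0 < δ := by linarith
  have hδ1 : δ ≤ 1 := by linarith
  have hαδ : α = 1 - δ := by linarith
  have hκ1 : 1 ≤ κ := by rw [hκ, one_le_div hσ]; exact hσL
  have hβ0 : 0 ≤ β := hβ ▸ NetworkDANE.homogeneity_nonneg f
  have hβL : β ≤ L := by
    have := NetworkDANE.homogeneity_le hn hσL hf
    linarith
  rw [← hδ] at hM ⊢
  have hμ : (σ + μ) * (σ * δ ^ 2) = 180 * L ^ 2 := by
    rw [hM, hκ]
    field_simp
  have hM0 : 0 < σ + μ := by rw [hM]; positivity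
  have hμ0 : 0 ≤ μ := by
    have h1 : σ * (σ * δ ^ 2) ≤ 180 * L ^ 2 := by
      have h1 : δ ^ 2 ≤ 1 := pow_le_one₀ hδ0.le hδ1
      have h2 : σ ^ 2 ≤ L ^ 2 := pow_le_pow_left₀ hσ.le hσL 2
      nlinarith [mul_le_mul_of_nonneg_left h1 (sq_nonneg σ)]
    rw [← hμ] at h1
    linarith [le_of_mul_le_mul_right h1 (by positivity)]
  have hgap : σ / (2 * (σ + μ)) = δ ^ 2 / (360 * κ ^ 2) := by
    rw [hM, hκ]
    field_simp
    norm_num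
  have hgap0 : 0 < σ / (2 * (σ + μ)) := by positivity
  have hgap1 : σ / (2 * (σ + μ)) < 1 := by
    rw [div_lt_one (by positivity)]
    linarith
  set ρ := 1 - σ / (2 * (σ + μ)) with hρ
  have hρ0 : 0 < ρ := by linarith
  have hconv : ∀ x₀ : Fin n → NetworkDANE.Vec d, ∃ C : ℝ, 0 < C ∧ ∀ t : ℕ, 1 ≤ t →
      NetworkDANE.error L f (NetworkDANE.run G W K μ f x₀ t) ≤ C * ρ ^ t := by
    intro x₀
    obtain ⟨V, hV⟩ := NetworkDANE.exists_errorsLE hσ hL hδ0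
      (NetworkDANE.argmin (NetworkDANE.globalLoss f)) (NetworkDANE.run G W K μ f x₀ 1)
    have hV0 := hV.nonneg
    -- Division by `ρ` accounts for starting at iteration 1; the added 1 keeps the constant positive
    -- if `V = 0`.
    refine ⟨V / ρ + 1, by positivity, fun t ht => ?_⟩
    obtain ⟨t, rfl⟩ := Nat.exists_eq_add_of_le' ht
    refine (NetworkDANE.error_le_of_errorsLE hn hf hσ hσL hδ1
      (NetworkDANE.average_tracker_run hn hW K μ f x₀ (t + 1))
      (hV.run hn hW hα₀.le hf hσ hσL hμ0 (hα ▸ hαδ) hδ0 hμ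
        (NetworkDANE.average_gradient_argmin hn hf hσ hσL) x₀ t)).trans ?_
    calc ρ ^ t * V = V / ρ * ρ ^ (t + 1) := by
          rw [pow_succ]
          field_simp
      _ ≤ (V / ρ + 1) * ρ ^ (t + 1) := by gcongr; linarith
  have hρ₂ : ∀ c : ℝ, 0 ≤ c → (δ * β) ^ 2 ≤ 90 * (c * L) ^ 2 →
      NetworkDANE.rho₂ σ L μ α β ≤ 1 - (1 - c) * (δ ^ 2 / (360 * κ ^ 2)) := by
    intro c hc hc'
    rw [hαδ, ← hgap]
    exact NetworkDANE.rho₂_le hσ hσL hδ0 hδ1 hμ hβL hc hc'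
  have hδκ : 0 ≤ δ ^ 2 / (360 * κ ^ 2) := by positivity
  have hδκ20 : (δ / 20) ^ 2 * (1 / κ ^ 2) = 9 / 10 * (δ ^ 2 / (360 * κ ^ 2)) := by
    field_simp
    norm_num
  have hδκ21 : (δ / 21) ^ 2 * (1 / κ ^ 2) = 360 / 441 * (δ ^ 2 / (360 * κ ^ 2)) := by
    field_simp
    norm_num
  refine ⟨⟨ρ, NetworkDANE.one_sub_le_rho₂ α hM0 hβ0, ?_,
    fun x₀ => ⟨hρ0, by linarith, hconv x₀⟩⟩, ?_, fun hsmall => ?_, fun x₀ => ?_⟩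
  · rw [hρ, hgap, hδκ20]
    linarith
  -- The share must satisfy `90 c² ≥ 1` and `1 - c ≥ 360/441`; `0.18` meets both.
  · refine (hρ₂ (18 / 100) (by norm_num) ?_).trans ?_
    · have h1 : δ * β ≤ L := (mul_le_of_le_one_left hβ0 hδ1).trans hβL
      have h2 := pow_le_pow_left₀ (mul_nonneg hδ0.le hβ0) h1 2
      nlinarith [sq_nonneg L]
    · rw [hδκ21]
      linarith
  -- `1 - c = 360/400` exactly, and `90 c² = 0.9` exceeds `(9/10)²`.
  · refine (hρ₂ (1 / 10) (by norm_num) ?_).trans ?_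
    · have h2 := pow_le_pow_left₀ (mul_nonneg hδ0.le hβ0) hsmall 2
      nlinarith [sq_nonneg L]
    · rw [hδκ20]
      linarith
  · obtain ⟨C, hC, hCt⟩ := hconv x₀
    -- `1/C` absorbs the constant; `exp (-1)` gives `log (1/ε) ≥ 1`, hence `X ≥ 1`, so rounding `720
    -- X` up stays below `1000 X`.
    refine ⟨min (1 / C) (Real.exp (-1)), lt_min (by positivity) (Real.exp_pos _),
      fun ε hε hε₀ => ?_⟩
    have hεC : C * ε ≤ 1 := by
      rw [mul_comm, ← le_div_iff₀ hC]
      exact hε₀.trans (min_le_left _ _)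
    have hlog : 1 ≤ Real.log (1 / ε) := by
      rw [one_div, Real.log_inv, le_neg, ← Real.log_exp (-1)]
      exact Real.log_le_log hε (hε₀.trans (min_le_right _ _))
    set X := κ ^ 2 * Real.log (1 / ε) / δ ^ 2 with hX
    have hX1 : 1 ≤ X := by
      rw [hX, le_div_iff₀ (by positivity), one_mul]
      calc δ ^ 2 ≤ 1 := pow_le_one₀ hδ0.le hδ1
        _ ≤ κ ^ 2 * Real.log (1 / ε) := one_le_mul_of_one_le_of_one_le (one_le_pow₀ hκ1) hlog
    have hXT : 2 * Real.log (1 / ε) / (σ / (2 * (σ + μ))) = 720 * X := by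
      rw [hgap, hX]
      field_simp
      norm_num
    have hT : (⌈720 * X⌉₊ : ℝ) ≤ 1000 * X := by
      have := Nat.ceil_lt_add_one (by linarith : 0 ≤ 720 * X)
      linarith
    refine ⟨⌈720 * X⌉₊, hT, ?_, fun t ht => ?_⟩
    · rw [NetworkDANE.rounds_run hn hW]
      push_cast
      calc (K : ℝ) * ⌈720 * X⌉₊ ≤ K * (1000 * X) := by gcongr
        _ = 1000 * (K * X) := by ring
    · have hT1 : 1 ≤ ⌈720 * X⌉₊ := Nat.one_le_ceil_iff.2 (by linarith)
      refine (hCt t (hT1.trans ht)).trans ?_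
      exact NetworkDANE.mul_pow_le_of_two_mul_log_div_le hρ0.le (Real.one_sub_le_exp_neg _) hgap0 hC
        hε hεC (hXT.trans_le (Nat.le_ceil _)) ht
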